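/- Let $\mathbb K$ be $\mathbb R$ or $\mathbb C$, let $w=\mathbb K^{\mathbb N_0}$, where $\mathbb N_0=\{0,1,2,\dots\}$ and $\mathbb N=\{1,2,\dots\}$, and let $p=(p_k)_{k\ge 0}$ be a bounded sequence of strictly positive real numbers. Put $l(p)=\{x\in w:\sum_k|x_k|^{p_k}<\infty\}$, $c_0(p)=\{x\in w:\lim_k|x_k|^{p_k}=0\}$, $c(p)=\{x\in w:\lim_k|x_k-l|^{p_k}=0\text{ for some }l\in\mathbb K\}$ and $l_\infty(p)=\{x\in w:\sup_k|x_k|^{p_k}<\infty\}$. Let $r,s,t\in w$ with $r_n\neq0$ and $t_n\neq0$ for all $n$, and $s_0\ne0$. For $X\in\{l(p),c_0(p),c(p),l_\infty(p)\}$ let $$X(r,s,t,p;\Delta)=\Big\{x\in w:\Big(\frac1{r_n}\sum_{k=0}^{n}s_{n-k}t_k\,\Delta x_k\Big)_{n}\in X\Big\},\qquad \Delta x_k=x_k-x_{k-1},\ x_{-1}=0,$$ and denote these spaces by $l(r,s,t,p;\Delta)$, $c_0(r,s,t,p;\Delta)$, $c(r,s,t,p;\Delta)$ and $l_\infty(r,s,t,p;\Delta)$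 respectively. The $\alpha$-dual of $U\subseteq w$ is $U^\alpha=\{a\in w:\sum_n|a_nu_n|<\infty\text{ for all }u\in U\}$. Let $D^{(s)}_0=1/s_0$ and, for $n\ge1$, $D^{(s)}_n=s_0^{-(n+1)}\det(d_{ij})_{1\le i,j\le n}$, where $d_{ij}=s_{i-j+1}$ if $j\le i+1$ and $d_{ij}=0$ otherwise. For $a\in w$ put $$c_{nk}=\sum_{j=0}^{n-k}(-1)^j\frac{D^{(s)}_j}{t_{j+k}}\,r_ka_n\quad(0\le k\le n),\qquad c_{nk}=0\quad(k>n).$$ With $F$ running over the finite subsets of $\mathbb N_0$, and $p_k'=p_k/(p_k-1)$ when $p_k>1$, let \begin{align*} H_1(p)&=\bigcup_{L\in\mathbb N}\Big\{a\in w:\sup_F\sum_{n=0}^\infty\Big|\sum_{k\in F}c_{nk}L^{-1/p_k}\Big|<\infty\Big\},\\ H_2(p)&=\Big\{a\in w:\sum_{n=0}^\infty\Big|\sum_{k=0}^\infty c_{nk}\Big|<\infty\Big\},\\ H_3(p)&=\bigcap_{L\in\mathbb N}\Big\{a\in w:\sup_F\sum_{n=0}^\infty\Big|\sum_{k\in F}c_{nk}L^{1/p_k}\Big|<\infty\Big\},\\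 H_4(p)&=\Big\{a\in w:\sup_F\sup_{k\in\mathbb N_0}\Big|\sum_{n\in F}c_{nk}\Big|^{p_k}<\infty\Big\},\\ H_5(p)&=\bigcup_{L\in\mathbb N}\Big\{a\in w:\sup_F\sum_{k=0}^\infty\Big|\sum_{n\in F}c_{nk}L^{-1}\Big|^{p_k'}<\infty\Big\}. \end{align*} Then: (a) if $p_k>1$ for all $k$, then $[l(r,s,t,p;\Delta)]^\alpha=H_5(p)$; if $0<p_k\le1$ for all $k$, then $[l(r,s,t,p;\Delta)]^\alpha=H_4(p)$; (b) for every such $p$: (i) $[c_0(r,s,t,p;\Delta)]^\alpha=H_1(p)$; (ii) $[c(r,s,t,p;\Delta)]^\alpha=H_1(p)\cap H_2(p)$; (iii) $[l_\infty(r,s,t,p;\Delta)]^\alpha=H_3(p)$. -/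

import Mathlib

namespace GenMeans

variable {𝕜 : Type*} [RCLike 𝕜]

/-- The Maddox space `l(p)`. -/
def lp (p : ℕ → ℝ) : Set (ℕ → 𝕜) := {x | Summable fun k => ‖x k‖ ^ p k}

/-- The Maddox space `c₀(p)`. -/
def c0 (p : ℕ → ℝ) : Set (ℕ → 𝕜) :=
  {x | Filter.Tendsto (fun k => ‖x k‖ ^ p k) Filter.atTop (nhds 0)}

/-- The Maddox space `c(p)`. -/
def c (p : ℕ → ℝ) : Set (ℕ → 𝕜) :=
  {x | ∃ l : 𝕜, Filter.Tendsto (fun k => ‖x k - l‖ ^ p k) Filter.atTop (nhds 0)}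

/-- The Maddox space `l_∞(p)`. -/
def linf (p : ℕ → ℝ) : Set (ℕ → 𝕜) := {x | BddAbove (Set.range fun k => ‖x k‖ ^ p k)}

/-- The space `l₁` of absolutely summable sequences. -/
def l1 : Set (ℕ → 𝕜) := {x | Summable fun k => ‖x k‖}

/-- The multiplier space `M(U, V)`. -/
def multiplier (U V : Set (ℕ → 𝕜)) : Set (ℕ → 𝕜) :=
  {a | ∀ u ∈ U, (fun n => a n * u n) ∈ V}

/-- The `α`-dual of a set of sequences. -/
def alphaDual (U : Set (ℕ → 𝕜)) : Set (ℕ → 𝕜) := multiplier U l1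

/-- The difference operator `(Δ x)ₖ = xₖ - xₖ₋₁`, with `x₋₁ = 0`. -/
def diff (x : ℕ → 𝕜) : ℕ → 𝕜
  | 0 => x 0
  | k + 1 => x (k + 1) - x k

/-- The generalized means of a sequence. -/
noncomputable def genMean (r s t x : ℕ → 𝕜) (n : ℕ) : 𝕜 :=
  1 / r n * ∑ k ∈ Finset.range (n + 1), s (n - k) * t k * x k

/-- The space `X(r, s, t; Δ)` of all `x` for which the generalized means of `Δ x` form a member
of `X`. -/
def space (X : Set (ℕ → 𝕜)) (r s t : ℕ → 𝕜) : Set (ℕ → 𝕜) :=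
  {x | genMean r s t (diff x) ∈ X}

/-- The number `Dₙ⁽ˢ⁾`: the determinant of the `n × n` matrix with `s₁` on the diagonal, `s₀` just
above it and `s_{i-j+1}` below it, divided by `s₀ⁿ⁺¹`. For `n = 0` it is `1 / s₀`. -/
noncomputable def D (s : ℕ → 𝕜) (n : ℕ) : 𝕜 :=
  1 / s 0 ^ (n + 1) *
    (Matrix.of fun i j : Fin n =>
      if (j : ℕ) ≤ (i : ℕ) + 1 then s ((i : ℕ) + 1 - (j : ℕ)) else 0).det

/-- The entry `∑_{j=0}^{n-k} (-1)ʲ Dⱼ⁽ˢ⁾ / t_{j+k} · rₖ aₙ`, an empty sum if `k > n`. -/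
noncomputable def C (r s t a : ℕ → 𝕜) (n k : ℕ) : 𝕜 :=
  if k ≤ n then
    ∑ j ∈ Finset.range (n - k + 1), (-1) ^ j * (D s j / t (j + k)) * r k * a n
  else 0

noncomputable def H1 (r s t : ℕ → 𝕜) (p : ℕ → ℝ) : Set (ℕ → 𝕜) :=
  {a | ∃ L : ℕ, 0 < L ∧
    (⨆ F : Finset ℕ, ∑' n, ‖∑ k ∈ F, C r s t a n k * (((L : ℝ) ^ (-1 / p k) : ℝ) : 𝕜)‖ₑ) < ⊤}

noncomputable def H2 (r s t : ℕ → 𝕜) : Set (ℕ → 𝕜) :=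
  {a | (∑' n, ‖∑' k, C r s t a n k‖ₑ) < ⊤}

noncomputable def H3 (r s t : ℕ → 𝕜) (p : ℕ → ℝ) : Set (ℕ → 𝕜) :=
  {a | ∀ L : ℕ, 0 < L →
    (⨆ F : Finset ℕ, ∑' n, ‖∑ k ∈ F, C r s t a n k * (((L : ℝ) ^ (1 / p k) : ℝ) : 𝕜)‖ₑ) < ⊤}

noncomputable def H4 (r s t : ℕ → 𝕜) (p : ℕ → ℝ) : Set (ℕ → 𝕜) :=
  {a | (⨆ F : Finset ℕ, ⨆ k : ℕ, ‖∑ n ∈ F, C r s t a n k‖ₑ ^ p k) < ⊤}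

noncomputable def H5 (r s t : ℕ → 𝕜) (p : ℕ → ℝ) : Set (ℕ → 𝕜) :=
  {a | ∃ L : ℕ, 0 < L ∧
    (⨆ F : Finset ℕ, ∑' k, ‖∑ n ∈ F, C r s t a n k * (L : 𝕜)⁻¹‖ₑ ^ (p k / (p k - 1))) < ⊤}

end GenMeans

namespace GenMeans

variable {𝕜 : Type*} [RCLike 𝕜]

/-! The generalized mean is convolution with `s` between two diagonal scalings, so it is inverted by
the reciprocal power series of `s`, whose coefficients are `(-1) ^ n * D s n` by Cramer's rule.
Summing the differences gives `a n * x n = tr (C r s t a) y n`, where `y` is the mean of `diff x`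
and ranges over all of `X`. Thus `a` lies in the `α`-dual iff the lower triangular matrix `C r s t
a` maps `X` into `l₁`, and what remains is to characterize such matrices.

Sufficiency: bounded finite subsums force absolute summability (`summable_norm_of_norm_sum_le`). A
finite sum over rows can be moved inside, onto the columns, and elementary estimates finish: weights
for `c0` and `linf`, Young's inequality or `p k ≤ 1` for `lp`.

Necessity: a gliding hump (`exists_not_summable_tr`). If the bound fails, arbitrarily far out there
are small blocks with transforms of `l₁`-norm at least 1; glued together they give an element of `X`
with transform outside `l₁`. The case `linf` reduces to `c0` with exponent 1 and a weighted matrix;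
the case `c` is `c0` plus constants. -/

/-- The transform of a sequence by the lower triangular part of an infinite matrix. -/
def tr (c : ℕ → ℕ → 𝕜) (y : ℕ → 𝕜) (n : ℕ) : 𝕜 :=
  ∑ k ∈ Finset.range (n + 1), c n k * y k

/-! ### Inversion of the means and reduction to matrix maps into `l₁`. -/

/-- The numbers `(-1)ⁿ Dₙ⁽ˢ⁾` are the coefficients of the inverse of the power series of `s`. -/
theorem coeff_inv_mk (s : ℕ → 𝕜) (hs : s 0 ≠ 0) (n : ℕ) :
    PowerSeries.coeff n (PowerSeries.mk s)⁻¹ = (-1) ^ n * D s n := by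
  set S := PowerSeries.mk s with hS
  set T : Matrix (Fin (n + 1)) (Fin (n + 1)) 𝕜 :=
    Matrix.of fun i j => if (j : ℕ) ≤ i then s (i - j) else 0 with hT
  set v : Fin (n + 1) → 𝕜 := fun j => PowerSeries.coeff j S⁻¹ with hv
  have hS0 : PowerSeries.constantCoeff S ≠ 0 := by simpa [hS] using hs
  have hSS : S * S⁻¹ = 1 := PowerSeries.mul_inv_cancel S hS0
  have hmul : T.mulVec v = Pi.single 0 1 := by
    funext i
    have h := congrArg (PowerSeries.coeff (i : ℕ)) hSS
    rw [mul_comm, PowerSeries.coeff_mul, Finset.Nat.sum_antidiagonal_eq_sum_range_succ_mk,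
      PowerSeries.coeff_one] at h
    have h1 : T.mulVec v i = ∑ j ∈ Finset.range (n + 1),
        (if j ≤ (i : ℕ) then s (i - j) else 0) * PowerSeries.coeff j S⁻¹ := by
      rw [Finset.sum_range]
      rfl
    rw [h1]
    have h2 : ∑ j ∈ Finset.range (n + 1),
        (if j ≤ (i : ℕ) then s (i - j) else 0) * PowerSeries.coeff j S⁻¹ =
        ∑ j ∈ Finset.range ((i : ℕ) + 1), PowerSeries.coeff j S⁻¹ * s (i - j) := by
      symm
      apply Finset.sum_subset_zero_on_sdiff
      · intro j hj
        have := i.2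
        simp only [Finset.mem_range] at *
        omega
      · intro j hj
        simp only [Finset.mem_sdiff, Finset.mem_range] at hj
        rw [if_neg (by omega), zero_mul]
      · intro j hj
        simp only [Finset.mem_range] at hj
        rw [if_pos (by omega), mul_comm]
    rw [h2]
    simp only [hS, PowerSeries.coeff_mk] at h
    rw [h]
    by_cases hi : i = 0
    · simp [hi]
    · have : (i : ℕ) ≠ 0 := fun h => hi (Fin.ext h)
      simp [this, hi]
  have hdet : T.det = s 0 ^ (n + 1) := by
    rw [Matrix.det_of_isLowerTriangular]
    · simp [hT]
    · intro i j hij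
      have : (i : ℕ) < j := hij
      simp only [hT, Matrix.of_apply]
      rw [if_neg (by omega)]
  -- Cramer's rule for the Toeplitz system `T v = e₀`. Deleting row 0 and the last column of `T`
  -- leaves the matrix of `D s n`; the cofactor supplies the sign.
  have hadj : T.det * v (Fin.last n) = T.adjugate (Fin.last n) 0 := by
    have h := congrArg (fun w => T.adjugate.mulVec w (Fin.last n)) hmul
    simpa [Matrix.mulVec_mulVec, Matrix.adjugate_mul, Matrix.smul_mulVec] using h
  rw [Matrix.adjugate_fin_succ_eq_det_submatrix, hdet] at hadj
  have hsub : T.submatrix (Fin.succAbove 0) (Fin.last n).succAbove =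
      Matrix.of fun i j : Fin n =>
        if (j : ℕ) ≤ (i : ℕ) + 1 then s ((i : ℕ) + 1 - (j : ℕ)) else 0 := by
    ext i j
    simp only [hT, Matrix.submatrix_apply, Matrix.of_apply, Fin.succAbove_zero, Fin.val_succ,
      Fin.succAbove_last, Fin.val_castSucc]
  rw [hsub] at hadj
  have hvn : v (Fin.last n) = PowerSeries.coeff n S⁻¹ := by simp [hv]
  rw [hvn] at hadj
  have hpow : s 0 ^ (n + 1) ≠ 0 := pow_ne_zero _ hs
  rw [D]
  field_simp
  rw [mul_comm, hadj]
  simp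

/-- Both sides compare coefficients in an identity of power series, before and after multiplication
by the inverse of the series of `s`. -/
theorem genMean_eq_iff (r s t : ℕ → 𝕜) (hr : ∀ n, r n ≠ 0) (hs : s 0 ≠ 0) (u y : ℕ → 𝕜) :
    genMean r s t u = y ↔
      ∀ m, t m * u m = ∑ k ∈ Finset.range (m + 1), (-1) ^ (m - k) * D s (m - k) * (r k * y k) := by
  set S := PowerSeries.mk s with hS
  have hS0 : PowerSeries.constantCoeff S ≠ 0 := by simpa [hS] using hs
  have h1 : genMean r s t u = y ↔
      PowerSeries.mk (fun k => t k * u k) * S = PowerSeries.mk (fun k => r k * y k) := by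
    rw [funext_iff, PowerSeries.ext_iff]
    refine forall_congr' fun n => ?_
    rw [PowerSeries.coeff_mul, Finset.Nat.sum_antidiagonal_eq_sum_range_succ_mk]
    simp only [hS, PowerSeries.coeff_mk, genMean]
    rw [one_div, inv_mul_eq_iff_eq_mul₀ (hr n)]
    have : ∀ k, s (n - k) * t k * u k = t k * u k * s (n - k) := fun k => by ring
    simp only [this]
  have h2 : PowerSeries.mk (fun k => t k * u k) * S = PowerSeries.mk (fun k => r k * y k) ↔
      PowerSeries.mk (fun k => t k * u k) = PowerSeries.mk (fun k => r k * y k) * S⁻¹ :=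
    (PowerSeries.eq_mul_inv_iff_mul_eq hS0).symm
  rw [h1, h2, PowerSeries.ext_iff]
  refine forall_congr' fun n => ?_
  rw [PowerSeries.coeff_mul, Finset.Nat.sum_antidiagonal_eq_sum_range_succ_mk]
  simp only [PowerSeries.coeff_mk, hS, coeff_inv_mk s hs]
  have : ∀ k, r k * y k * ((-1) ^ (n - k) * D s (n - k)) =
    (-1) ^ (n - k) * D s (n - k) * (r k * y k) := fun k => by ring
  simp only [this]

theorem sum_range_diff (x : ℕ → 𝕜) (n : ℕ) : ∑ k ∈ Finset.range (n + 1), diff x k = x n := by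
  induction n with
  | zero => simp [diff]
  | succ n ih => rw [Finset.sum_range_succ, ih, diff]; ring

theorem exists_diff_eq (u : ℕ → 𝕜) : ∃ x, diff x = u := by
  refine ⟨fun n => ∑ k ∈ Finset.range (n + 1), u k, ?_⟩
  funext n
  cases n with
  | zero => simp [diff]
  | succ n => simp [diff, Finset.sum_range_succ]

theorem mul_eq_tr_C (r s t a : ℕ → 𝕜) (hr : ∀ n, r n ≠ 0) (ht : ∀ n, t n ≠ 0) (hs : s 0 ≠ 0)
    (x : ℕ → 𝕜) (n : ℕ) : a n * x n = tr (C r s t a) (genMean r s t (diff x)) n := by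
  set y := genMean r s t (diff x) with hy
  have h := (genMean_eq_iff r s t hr hs (diff x) y).1 hy.symm
  have hd : ∀ m, diff x m =
      ∑ k ∈ Finset.range (m + 1), (-1) ^ (m - k) * D s (m - k) * (r k * y k) / t m := by
    intro m
    rw [← Finset.sum_div, ← h m, mul_div_cancel_left₀ _ (ht m)]
  rw [← sum_range_diff x n, tr, Finset.mul_sum]
  simp only [hd, Finset.mul_sum]
  rw [Finset.sum_sigma', Finset.sum_congr rfl (g := fun k => ∑ j ∈ Finset.range (n - k + 1),
    (-1) ^ j * (D s j / t (j + k)) * r k * a n * y k)]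
  · rw [Finset.sum_sigma']
    -- The triangle `k ≤ m ≤ n` is reindexed by `(k, j)` with `j = m - k`.
    refine Finset.sum_bij' (fun q _ => ⟨q.2, q.1 - q.2⟩) (fun q _ => ⟨q.2 + q.1, q.1⟩) ?_ ?_ ?_ ?_ ?_
    · rintro ⟨m, k⟩ hq
      simp only [Finset.mem_sigma, Finset.mem_range] at *
      omega
    · rintro ⟨m, k⟩ hq
      simp only [Finset.mem_sigma, Finset.mem_range] at *
      omega
    · rintro ⟨m, k⟩ hq
      simp only [Finset.mem_sigma, Finset.mem_range] at *
      have : m - k + k = m := by omega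
      simp [this]
    · rintro ⟨m, k⟩ hq
      simp
    · rintro ⟨m, k⟩ hq
      simp only [Finset.mem_sigma, Finset.mem_range] at *
      have : m - k + k = m := by omega
      rw [this]
      ring
  · intro k hk
    rw [C, if_pos (by simpa [Nat.lt_succ_iff] using hk), Finset.sum_mul]

/-- The `α`-dual of `X(r, s, t; Δ)` consists of all `a` whose matrix maps `X` into `l₁`. -/
theorem mem_alphaDual_space_iff (r s t : ℕ → 𝕜) (hr : ∀ n, r n ≠ 0) (ht : ∀ n, t n ≠ 0)
    (hs : s 0 ≠ 0) (X : Set (ℕ → 𝕜)) (a : ℕ → 𝕜) :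
    a ∈ alphaDual (space X r s t) ↔ ∀ y ∈ X, Summable fun n => ‖tr (C r s t a) y n‖ := by
  constructor
  · intro h y hy
    obtain ⟨x, hx⟩ := exists_diff_eq fun m =>
      (∑ k ∈ Finset.range (m + 1), (-1) ^ (m - k) * D s (m - k) * (r k * y k)) / t m
    have hxy : genMean r s t (diff x) = y := by
      rw [genMean_eq_iff r s t hr hs]
      intro m
      rw [hx, mul_div_cancel₀ _ (ht m)]
    have h1 : Summable fun n => ‖a n * x n‖ := h x (by rwa [space, Set.mem_ofPred_eq, hxy])
    simpa only [mul_eq_tr_C r s t a hr ht hs, hxy] using h1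
  · intro h x hx
    have h1 := h _ hx
    change Summable fun n => ‖a n * x n‖
    simpa only [mul_eq_tr_C r s t a hr ht hs] using h1

theorem C_eq_zero (r s t a : ℕ → 𝕜) (n k : ℕ) (h : n < k) : C r s t a n k = 0 := by
  rw [C, if_neg (by omega)]

/-! ### Absolute sums controlled by finite subsums. -/

theorem sum_abs_le_two_mul {ι : Type*} (f : ι → ℝ) (M : ℝ) (G : Finset ι)
    (h : ∀ F ⊆ G, |∑ i ∈ F, f i| ≤ M) : ∑ i ∈ G, |f i| ≤ 2 * M := by
  classical
  rw [← Finset.sum_filter_add_sum_filter_not G (fun i => 0 ≤ f i)]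
  have h1 : ∑ i ∈ G with 0 ≤ f i, |f i| ≤ M := by
    rw [Finset.sum_congr rfl fun i hi => abs_of_nonneg (Finset.mem_filter.1 hi).2]
    exact (le_abs_self _).trans (h _ (Finset.filter_subset _ _))
  have h2 : ∑ i ∈ G with ¬ 0 ≤ f i, |f i| ≤ M := by
    rw [Finset.sum_congr rfl fun i hi => abs_of_neg (not_le.1 (Finset.mem_filter.1 hi).2),
      Finset.sum_neg_distrib]
    exact (neg_le_abs _).trans (h _ (Finset.filter_subset _ _))
  linarith

/-- Splitting into positive and negative real and imaginary parts gives four subsums, each at most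
`M`. -/
theorem sum_norm_le_four_mul {ι : Type*} (z : ι → 𝕜) (M : ℝ) (G : Finset ι)
    (h : ∀ F ⊆ G, ‖∑ i ∈ F, z i‖ ≤ M) : ∑ i ∈ G, ‖z i‖ ≤ 4 * M := by
  have hre : ∑ i ∈ G, |RCLike.re (z i)| ≤ 2 * M :=
    sum_abs_le_two_mul _ M G fun F hF => by
      rw [← map_sum]
      exact (RCLike.abs_re_le_norm _).trans (h F hF)
  have him : ∑ i ∈ G, |RCLike.im (z i)| ≤ 2 * M :=
    sum_abs_le_two_mul _ M G fun F hF => by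
      rw [← map_sum]
      exact (RCLike.abs_im_le_norm _).trans (h F hF)
  have : ∑ i ∈ G, ‖z i‖ ≤ ∑ i ∈ G, (|RCLike.re (z i)| + |RCLike.im (z i)|) :=
    Finset.sum_le_sum fun i _ => by
      conv_lhs => rw [← RCLike.re_add_im (z i)]
      refine (norm_add_le _ _).trans (add_le_add ?_ ?_)
      · rw [RCLike.norm_ofReal]
      · rw [norm_mul, RCLike.norm_ofReal]
        exact mul_le_of_le_one_right (abs_nonneg _) (by rw [RCLike.norm_I]; split_ifs <;> norm_num)
  rw [Finset.sum_add_distrib] at this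
  linarith

theorem summable_norm_of_norm_sum_le {ι : Type*} (z : ι → 𝕜) (M : ℝ)
    (h : ∀ G : Finset ι, ‖∑ i ∈ G, z i‖ ≤ M) : Summable fun i => ‖z i‖ :=
  summable_of_sum_le (fun _ => norm_nonneg _) fun G => sum_norm_le_four_mul z M G fun F _ => h F

/-! ### Sufficiency of the conditions. -/

theorem tr_eq_sum_range (c : ℕ → ℕ → 𝕜) (hc : ∀ n k, n < k → c n k = 0) (y : ℕ → 𝕜) {n N : ℕ}
    (h : n < N) : tr c y n = ∑ k ∈ Finset.range N, c n k * y k := by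
  refine Finset.sum_subset (fun k hk => ?_) fun k _ hk => ?_
  · simp only [Finset.mem_range] at *; omega
  · simp only [Finset.mem_range] at *
    rw [hc n k (by omega), zero_mul]

theorem exists_sum_tr (c : ℕ → ℕ → 𝕜) (hc : ∀ n k, n < k → c n k = 0) (G : Finset ℕ) :
    ∃ N, ∀ y, ∑ n ∈ G, tr c y n = ∑ k ∈ Finset.range N, (∑ n ∈ G, c n k) * y k := by
  refine ⟨G.sup id + 1, fun y => ?_⟩
  have : ∀ n ∈ G, tr c y n = ∑ k ∈ Finset.range (G.sup id + 1), c n k * y k := fun n hn =>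
    tr_eq_sum_range c hc y (Nat.lt_succ_of_le (Finset.le_sup (f := id) hn))
  rw [Finset.sum_congr rfl this, Finset.sum_comm]
  simp only [Finset.sum_mul]

/-- If the sums of the columns of `b` over finite sets are bounded in `l₁`, then `b` maps bounded
sequences into `l₁`. -/
theorem summable_tr_of_bounded (b : ℕ → ℕ → 𝕜) (hb : ∀ n k, n < k → b n k = 0)
    (h : (⨆ F : Finset ℕ, ∑' n, ‖∑ k ∈ F, b n k‖ₑ) < ⊤) (u : ℕ → 𝕜) (B : ℝ)
    (hu : ∀ k, ‖u k‖ ≤ B) : Summable fun n => ‖tr b u n‖ := by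
  set M := ⨆ F : Finset ℕ, ∑' n, ‖∑ k ∈ F, b n k‖ₑ with hM
  have hB : 0 ≤ B := (norm_nonneg _).trans (hu 0)
  refine summable_norm_of_norm_sum_le _ (4 * M.toReal * B) fun G => ?_
  obtain ⟨N, hN⟩ := exists_sum_tr b hb G
  rw [hN]
  calc ‖∑ k ∈ Finset.range N, (∑ n ∈ G, b n k) * u k‖
      ≤ ∑ k ∈ Finset.range N, ‖∑ n ∈ G, b n k‖ * B := by
        refine norm_sum_le_of_le _ fun k _ => ?_
        rw [norm_mul]
        exact mul_le_mul_of_nonneg_left (hu k) (norm_nonneg _)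
    _ = (∑ k ∈ Finset.range N, ‖∑ n ∈ G, b n k‖) * B := by rw [Finset.sum_mul]
    _ ≤ 4 * M.toReal * B := by
        refine mul_le_mul_of_nonneg_right ?_ hB
        -- The roles of rows and columns are exchanged: for fixed `G`, only the subsums over `k ∈ F`
        -- need a bound, and the hypothesis gives `M`.
        refine sum_norm_le_four_mul _ _ _ fun F _ => ?_
        rw [Finset.sum_comm, ← toReal_enorm]
        refine ENNReal.toReal_mono h.ne ?_
        calc ‖∑ n ∈ G, ∑ k ∈ F, b n k‖ₑ ≤ ∑ n ∈ G, ‖∑ k ∈ F, b n k‖ₑ := enorm_sum_le _ _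
          _ ≤ ∑' n, ‖∑ k ∈ F, b n k‖ₑ := ENNReal.sum_le_tsum G
          _ ≤ M := le_iSup (fun F : Finset ℕ => ∑' n, ‖∑ k ∈ F, b n k‖ₑ) F

theorem tr_mul_right (c : ℕ → ℕ → 𝕜) (w y : ℕ → 𝕜) :
    tr (fun n k => c n k * w k) y = tr c fun k => w k * y k := by
  funext n
  simp only [tr, mul_assoc]

/-- The weighted version of `summable_tr_of_bounded`. -/
theorem summable_tr_of_weight (c : ℕ → ℕ → 𝕜) (hc : ∀ n k, n < k → c n k = 0) (w : ℕ → ℝ)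
    (hw : ∀ k, 0 < w k)
    (h : (⨆ F : Finset ℕ, ∑' n, ‖∑ k ∈ F, c n k * (w k : 𝕜)‖ₑ) < ⊤) (y : ℕ → 𝕜) (B : ℝ)
    (hy : ∀ k, ‖y k‖ ≤ B * w k) : Summable fun n => ‖tr c y n‖ := by
  have h1 := summable_tr_of_bounded (fun n k => c n k * (w k : 𝕜))
    (fun n k hnk => by rw [hc n k hnk, zero_mul]) h (fun k => (w k : 𝕜)⁻¹ * y k) B fun k => by
      rw [norm_mul, norm_inv, RCLike.norm_of_nonneg (hw k).le, inv_mul_eq_div, div_le_iff₀ (hw k)]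
      exact hy k
  rw [tr_mul_right] at h1
  have h2 : ∀ k, (w k : 𝕜) * ((w k : 𝕜)⁻¹ * y k) = y k := fun k =>
    mul_inv_cancel_left₀ (RCLike.ofReal_ne_zero.2 (hw k).ne') _
  simpa only [h2] using h1

theorem summable_tr_of_mem_c0 (c : ℕ → ℕ → 𝕜) (hc : ∀ n k, n < k → c n k = 0) (p : ℕ → ℝ)
    (hp : ∀ k, 0 < p k) (L : ℕ) (hL : 0 < L)
    (h : (⨆ F : Finset ℕ, ∑' n,
      ‖∑ k ∈ F, c n k * (((L : ℝ) ^ (-1 / p k) : ℝ) : 𝕜)‖ₑ) < ⊤)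
    (y : ℕ → 𝕜) (hy : y ∈ c0 p) : Summable fun n => ‖tr c y n‖ := by
  have hL' : (0 : ℝ) < L := by exact_mod_cast hL
  have hw : ∀ k, 0 < (L : ℝ) ^ (-1 / p k) := fun k => Real.rpow_pos_of_pos hL' _
  -- Eventually `‖y k‖ ^ p k < 1 / L`, so the weight dominates `‖y k‖`; the finitely many other
  -- terms only enlarge `B`.
  have hev : ∀ᶠ k in Filter.atTop, ‖y k‖ / (L : ℝ) ^ (-1 / p k) ≤ 1 := by
    have hy' : Filter.Tendsto (fun k => ‖y k‖ ^ p k) Filter.atTop (nhds 0) := hy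
    filter_upwards [hy'.eventually_lt_const (inv_pos.2 hL')] with k hk
    rw [div_le_one (hw k)]
    have h1 := Real.rpow_le_rpow (Real.rpow_nonneg (norm_nonneg _) _) hk.le
      (inv_nonneg.2 (hp k).le)
    rw [Real.rpow_rpow_inv (norm_nonneg _) (hp k).ne', Real.inv_rpow hL'.le,
      ← Real.rpow_neg hL'.le] at h1
    rwa [neg_div, one_div]
  obtain ⟨B, hB⟩ : BddAbove (Set.range fun k => ‖y k‖ / (L : ℝ) ^ (-1 / p k)) :=
    Filter.IsBoundedUnder.bddAbove_range (Filter.isBoundedUnder_of_eventually_le hev)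
  exact summable_tr_of_weight c hc _ hw h y B fun k =>
    (div_le_iff₀ (hw k)).1 (hB (Set.mem_range_self k))

theorem summable_tr_of_mem_linf (c : ℕ → ℕ → 𝕜) (hc : ∀ n k, n < k → c n k = 0) (p : ℕ → ℝ)
    (hp : ∀ k, 0 < p k)
    (h : ∀ L : ℕ, 0 < L → (⨆ F : Finset ℕ, ∑' n,
      ‖∑ k ∈ F, c n k * (((L : ℝ) ^ (1 / p k) : ℝ) : 𝕜)‖ₑ) < ⊤)
    (y : ℕ → 𝕜) (hy : y ∈ linf p) : Summable fun n => ‖tr c y n‖ := by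
  obtain ⟨B, hB⟩ : BddAbove (Set.range fun k => ‖y k‖ ^ p k) := hy
  obtain ⟨L, hL⟩ := exists_nat_gt (max B 0)
  have hL' : (0 : ℝ) < L := (le_max_right _ _).trans_lt hL
  refine summable_tr_of_weight c hc _ (fun k => Real.rpow_pos_of_pos hL' _)
    (h L (by exact_mod_cast hL')) y 1 fun k => ?_
  have h0 : ‖y k‖ ^ p k ≤ L := (hB (Set.mem_range_self k)).trans ((le_max_left _ _).trans hL.le)
  have h1 := Real.rpow_le_rpow (Real.rpow_nonneg (norm_nonneg _) _) h0 (inv_nonneg.2 (hp k).le)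
  rw [Real.rpow_rpow_inv (norm_nonneg _) (hp k).ne'] at h1
  rwa [one_mul, one_div]

/-- Column sums are at most `M ^ (1 / p k)`. Once `M * ‖y k‖ ^ p k ≤ 1`, raising it to the power `1
/ p k ≥ 1` can only decrease it, so `M ^ (1 / p k) * ‖y k‖` is summable. -/
theorem summable_tr_of_mem_lp_of_le_one (c : ℕ → ℕ → 𝕜) (hc : ∀ n k, n < k → c n k = 0)
    (p : ℕ → ℝ) (hp : ∀ k, 0 < p k) (hp1 : ∀ k, p k ≤ 1)
    (h : (⨆ F : Finset ℕ, ⨆ k : ℕ, ‖∑ n ∈ F, c n k‖ₑ ^ p k) < ⊤)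
    (y : ℕ → 𝕜) (hy : y ∈ lp p) : Summable fun n => ‖tr c y n‖ := by
  have hy' : Summable fun k => ‖y k‖ ^ p k := hy
  obtain ⟨M, hM0, hM⟩ : ∃ M : ℝ, 0 < M ∧ ∀ (F : Finset ℕ) k, ‖∑ n ∈ F, c n k‖ ^ p k ≤ M := by
    refine ⟨(⨆ F : Finset ℕ, ⨆ k : ℕ, ‖∑ n ∈ F, c n k‖ₑ ^ p k).toReal + 1, by positivity,
      fun F k => ?_⟩
    have h1 : ‖∑ n ∈ F, c n k‖ₑ ^ p k ≤ ⨆ F : Finset ℕ, ⨆ k : ℕ, ‖∑ n ∈ F, c n k‖ₑ ^ p k :=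
      le_iSup₂ (f := fun (F : Finset ℕ) (k : ℕ) => ‖∑ n ∈ F, c n k‖ₑ ^ p k) F k
    have h2 := ENNReal.toReal_mono h.ne h1
    rw [← ENNReal.toReal_rpow, toReal_enorm] at h2
    linarith
  have hsum : Summable fun k => M ^ (p k)⁻¹ * ‖y k‖ := by
    have hev : ∀ᶠ k in Filter.atTop, M * ‖y k‖ ^ p k ≤ 1 := by
      have := (hy'.mul_left M).tendsto_atTop_zero
      exact (this.eventually_lt_const one_pos).mono fun k hk => hk.le
    refine Summable.of_norm_bounded_eventually_nat (hy'.mul_left M) ?_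
    filter_upwards [hev] with k hk
    rw [Real.norm_of_nonneg (by positivity)]
    have h3 : M ^ (p k)⁻¹ * ‖y k‖ = (M * ‖y k‖ ^ p k) ^ (p k)⁻¹ := by
      rw [Real.mul_rpow hM0.le (by positivity), Real.rpow_rpow_inv (norm_nonneg _) (hp k).ne']
    rw [h3]
    exact Real.rpow_le_self_of_le_one (by positivity) hk ((one_le_inv₀ (hp k)).2 (hp1 k))
  refine summable_norm_of_norm_sum_le _ (∑' k, M ^ (p k)⁻¹ * ‖y k‖) fun G => ?_
  obtain ⟨N, hN⟩ := exists_sum_tr c hc G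
  rw [hN]
  refine (norm_sum_le_of_le _ fun k _ => ?_).trans
    (hsum.sum_le_tsum (Finset.range N) fun k _ => by positivity)
  rw [norm_mul]
  refine mul_le_mul_of_nonneg_right ?_ (norm_nonneg _)
  have h1 := Real.rpow_le_rpow (Real.rpow_nonneg (norm_nonneg _) _) (hM G k)
    (inv_nonneg.2 (hp k).le)
  rwa [Real.rpow_rpow_inv (norm_nonneg _) (hp k).ne'] at h1

/-- Young's inequality is applied termwise to the scaled column sum `d k` and `y k`; the factors `1
/ p k` and `1 / q k` are dropped. -/
theorem summable_tr_of_mem_lp_of_one_lt (c : ℕ → ℕ → 𝕜) (hc : ∀ n k, n < k → c n k = 0)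
    (p : ℕ → ℝ) (hp1 : ∀ k, 1 < p k) (L : ℕ) (hL : 0 < L)
    (h : (⨆ F : Finset ℕ, ∑' k,
      ‖∑ n ∈ F, c n k * (L : 𝕜)⁻¹‖ₑ ^ (p k / (p k - 1))) < ⊤)
    (y : ℕ → 𝕜) (hy : y ∈ lp p) : Summable fun n => ‖tr c y n‖ := by
  have hy' : Summable fun k => ‖y k‖ ^ p k := hy
  have hL' : (0 : ℝ) < L := by exact_mod_cast hL
  have hL𝕜 : (L : 𝕜) ≠ 0 := by exact_mod_cast hL.ne'
  set M := ⨆ F : Finset ℕ, ∑' k, ‖∑ n ∈ F, c n k * (L : 𝕜)⁻¹‖ₑ ^ (p k / (p k - 1)) with hM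
  refine summable_norm_of_norm_sum_le _ (L * (M.toReal + ∑' k, ‖y k‖ ^ p k)) fun G => ?_
  obtain ⟨N, hN⟩ := exists_sum_tr c hc G
  rw [hN]
  set d : ℕ → 𝕜 := fun k => ∑ n ∈ G, c n k * (L : 𝕜)⁻¹ with hd
  have hcd : ∀ k, ∑ n ∈ G, c n k = L * d k := fun k => by
    simp only [hd]
    rw [← Finset.sum_mul, mul_left_comm, mul_inv_cancel₀ hL𝕜, mul_one]
  have hdM : ∑ k ∈ Finset.range N, ‖d k‖ ^ (p k / (p k - 1)) ≤ M.toReal := by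
    have h1 : ∑ k ∈ Finset.range N, ‖d k‖ₑ ^ (p k / (p k - 1)) ≤ M :=
      (ENNReal.sum_le_tsum _).trans (le_iSup (fun F : Finset ℕ => ∑' k,
        ‖∑ n ∈ F, c n k * (L : 𝕜)⁻¹‖ₑ ^ (p k / (p k - 1))) G)
    have h2 := ENNReal.toReal_mono h.ne h1
    rw [ENNReal.toReal_sum] at h2
    · simpa only [← ENNReal.toReal_rpow, toReal_enorm] using h2
    · intro k _
      have : 0 < p k - 1 := sub_pos.2 (hp1 k)
      exact ENNReal.rpow_ne_top_of_nonneg (div_nonneg (by linarith) this.le) enorm_ne_top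
  have hyN := hy'.sum_le_tsum (Finset.range N) fun k _ => by positivity
  calc ‖∑ k ∈ Finset.range N, (∑ n ∈ G, c n k) * y k‖
      ≤ ∑ k ∈ Finset.range N, L * (‖d k‖ ^ (p k / (p k - 1)) + ‖y k‖ ^ p k) := by
        refine norm_sum_le_of_le _ fun k _ => ?_
        rw [hcd, norm_mul, norm_mul, RCLike.norm_natCast, mul_assoc]
        refine mul_le_mul_of_nonneg_left ?_ hL'.le
        have hconj : (p k).HolderConjugate (p k / (p k - 1)) :=
          Real.HolderConjugate.conjExponent (hp1 k)
        have hyoung := Real.young_inequality_of_nonneg (norm_nonneg (d k)) (norm_nonneg (y k))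
          hconj.symm
        refine hyoung.trans (add_le_add ?_ ?_)
        · exact div_le_self (by positivity) hconj.symm.lt.le
        · exact div_le_self (by positivity) hconj.lt.le
    _ = L * (∑ k ∈ Finset.range N, ‖d k‖ ^ (p k / (p k - 1)) +
          ∑ k ∈ Finset.range N, ‖y k‖ ^ p k) := by
        rw [← Finset.mul_sum, Finset.sum_add_distrib]
    _ ≤ _ := mul_le_mul_of_nonneg_left (add_le_add hdM hyN) hL'.le

/-! ### The gliding hump. -/

/-- One hump. Past row `J` the first `K` columns have total mass below 1/4, while a block supported
beyond `J` has transform mass at least 1/2 before row `K'`. Entries of `z` from `K'` on do not reach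
these rows, since `tr` is lower triangular. -/
theorem exists_block (c : ℕ → ℕ → 𝕜) (hcol : ∀ k, Summable fun n => ‖c n k‖) (Q : (ℕ → 𝕜) → Prop)
    (h : ∀ K, ∃ (x : ℕ → 𝕜) (K' : ℕ), (∀ k, k < K → x k = 0) ∧ (∀ k, K' ≤ k → x k = 0) ∧ Q x ∧
      1 ≤ ∑' n, ‖tr c x n‖ₑ) (K : ℕ) :
    ∃ (K' : ℕ) (x : ℕ → 𝕜), K < K' ∧ (∀ k, k < K → x k = 0) ∧ (∀ k, K' ≤ k → x k = 0) ∧ Q x ∧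
      ∀ z : ℕ → 𝕜, (∀ k, k < K → ‖z k‖ ≤ 1) → (∀ k, K ≤ k → k < K' → z k = x k) →
        1 / 4 ≤ ∑ n ∈ Finset.Ico K K', ‖tr c z n‖ := by
  set g : ℕ → ℝ := fun n => ∑ k ∈ Finset.range K, ‖c n k‖ with hg
  have hgs : Summable g := summable_sum fun k _ => hcol k
  have hg0 : ∀ n, 0 ≤ g n := fun n => Finset.sum_nonneg fun k _ => norm_nonneg _
  obtain ⟨J, hJ, hJK⟩ := ((hgs.hasSum.tendsto_sum_nat.eventually_const_lt
    (show ∑' n, g n - 1 / 4 < ∑' n, g n by linarith)).and (Filter.eventually_ge_atTop K)).exists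
  obtain ⟨x, K₁, hx0, hx1, hQ, hq⟩ := h J
  obtain ⟨K₂, hK₂⟩ : ∃ N, 1 / 2 ≤ ∑ n ∈ Finset.range N, ‖tr c x n‖ := by
    rw [ENNReal.tsum_eq_iSup_nat] at hq
    have h12 : ENNReal.ofReal (1 / 2) < 1 := by
      rw [ENNReal.ofReal_lt_one]; norm_num
    obtain ⟨N, hN⟩ := lt_iSup_iff.1 (h12.trans_le hq)
    refine ⟨N, ?_⟩
    simp only [← ofReal_norm] at hN
    rw [← ENNReal.ofReal_sum_of_nonneg fun _ _ => norm_nonneg _] at hN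
    exact (ENNReal.ofReal_lt_ofReal_iff_of_nonneg (by norm_num)).1 hN |>.le
  obtain ⟨K', h1, h2, h3, h4⟩ : ∃ K', K < K' ∧ J ≤ K' ∧ K₁ ≤ K' ∧ K₂ ≤ K' :=
    ⟨K + J + K₁ + K₂ + 1, by omega, by omega, by omega, by omega⟩
  refine ⟨K', x, h1, fun k hk => hx0 k (by omega), fun k hk => hx1 k (by omega), hQ,
    fun z hz hzx => ?_⟩
  have hdiff : ∀ n ∈ Finset.Ico J K', ‖tr c x n‖ - g n ≤ ‖tr c z n‖ := by
    intro n hn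
    rw [Finset.mem_Ico] at hn
    have hsub : ‖tr c x n - tr c z n‖ ≤ g n := by
      rw [tr, tr, ← Finset.sum_sub_distrib, ← Finset.sum_subset (s₁ := Finset.range K)]
      · refine norm_sum_le_of_le _ fun k hk => ?_
        rw [Finset.mem_range] at hk
        rw [hx0 k (by omega), mul_zero, zero_sub, norm_neg, norm_mul]
        exact mul_le_of_le_one_right (norm_nonneg _) (hz k hk)
      · intro k hk
        simp only [Finset.mem_range] at *
        omega
      · intro k hk hk'
        simp only [Finset.mem_range] at *
        rw [hzx k (by omega) (by omega), sub_self]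
    have := norm_sub_norm_le (tr c x n) (tr c z n)
    linarith
  have hxJ : ∑ n ∈ Finset.range J, ‖tr c x n‖ = 0 := by
    refine Finset.sum_eq_zero fun n hn => ?_
    rw [Finset.mem_range] at hn
    rw [norm_eq_zero]
    refine Finset.sum_eq_zero fun k hk => ?_
    rw [Finset.mem_range] at hk
    rw [hx0 k (by omega), mul_zero]
  have hxs : 1 / 2 ≤ ∑ n ∈ Finset.Ico J K', ‖tr c x n‖ := by
    rw [Finset.sum_Ico_eq_sub _ h2, hxJ, sub_zero]
    refine hK₂.trans (Finset.sum_le_sum_of_subset_of_nonneg ?_ fun _ _ _ => norm_nonneg _)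
    exact Finset.range_mono h4
  have hgK : ∑ n ∈ Finset.Ico J K', g n ≤ 1 / 4 := by
    rw [Finset.sum_Ico_eq_sub _ h2]
    have := hgs.sum_le_tsum (Finset.range K') fun n _ => hg0 n
    linarith
  calc (1 / 4 : ℝ) ≤ ∑ n ∈ Finset.Ico J K', (‖tr c x n‖ - g n) := by
        rw [Finset.sum_sub_distrib]; linarith
    _ ≤ ∑ n ∈ Finset.Ico J K', ‖tr c z n‖ := Finset.sum_le_sum hdiff
    _ ≤ ∑ n ∈ Finset.Ico K K', ‖tr c z n‖ :=
        Finset.sum_le_sum_of_subset_of_nonneg (Finset.Ico_subset_Ico_left hJK)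
          fun _ _ _ => norm_nonneg _

/-- Gliding hump: if arbitrarily far out there are finite blocks, subject to a condition `P i`, whose
transforms have `l₁`-norm at least `1`, then some sequence pieced together from such blocks has a
transform outside `l₁`. -/
theorem exists_not_summable_tr (c : ℕ → ℕ → 𝕜) (hcol : ∀ k, Summable fun n => ‖c n k‖)
    (P : ℕ → (ℕ → 𝕜) → Prop) (hP : ∀ i x, P i x → ∀ k, ‖x k‖ ≤ 1)
    (h : ∀ i K, ∃ (x : ℕ → 𝕜) (K' : ℕ), (∀ k, k < K → x k = 0) ∧ (∀ k, K' ≤ k → x k = 0) ∧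
      P i x ∧ 1 ≤ ∑' n, ‖tr c x n‖ₑ) :
    ∃ (N : ℕ → ℕ) (x : ℕ → ℕ → 𝕜) (y : ℕ → 𝕜), N 0 = 0 ∧ (∀ i, P i (x i)) ∧
      (∀ i k, N i ≤ k → ∃ j, i ≤ j ∧ y k = x j k) ∧ ¬ Summable fun n => ‖tr c y n‖ := by
  choose E X hE hX0 hX1 hPX hX using fun i => exists_block c hcol (P i) (h i)
  set N : ℕ → ℕ := fun i => Nat.rec 0 (fun i K => E i K) i with hN
  have hN0 : N 0 = 0 := rfl
  have hNs : ∀ i, N (i + 1) = E i (N i) := fun i => rfl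
  have hmono : StrictMono N := strictMono_nat_of_lt_succ fun i => by rw [hNs]; exact hE i (N i)
  set x : ℕ → ℕ → 𝕜 := fun i => X i (N i) with hx
  -- The block `x i` lives on `[N i, N (i + 1))` and `i ≤ N i`, so only `i ≤ k` can contribute at
  -- `k`.
  set y : ℕ → 𝕜 := fun k => ∑ i ∈ Finset.range (k + 1), x i k with hy
  have hyx : ∀ i k, N i ≤ k → k < N (i + 1) → y k = x i k := by
    intro i k h1 h2
    refine Finset.sum_eq_single i (fun j _ hj => ?_) fun hi => ?_
    · rcases lt_or_gt_of_ne hj with hj | hj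
      · refine hX1 j (N j) k ?_
        rw [← hNs]
        exact (hmono.monotone hj).trans h1
      · exact hX0 j (N j) k (h2.trans_le (hmono.monotone hj))
    · exact absurd (Finset.mem_range.2 (Nat.lt_succ_of_le ((hmono.le_apply).trans h1))) hi
  have hblock : ∀ k, ∃ j, N j ≤ k ∧ k < N (j + 1) := by
    intro k
    have hex : ∃ j, k < N (j + 1) := ⟨k, (Nat.lt_succ_self k).trans_le hmono.le_apply⟩
    refine ⟨Nat.find hex, ?_, Nat.find_spec hex⟩
    rcases Nat.eq_zero_or_eq_succ_pred (Nat.find hex) with h0 | h0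
    · rw [h0, hN0]; exact Nat.zero_le _
    · have := Nat.find_min hex (m := (Nat.find hex).pred) (by omega)
      rw [h0]
      simpa using this
  refine ⟨N, x, y, hN0, fun i => hPX i (N i), fun i k hik => ?_, fun hsum => ?_⟩
  · obtain ⟨j, hj1, hj2⟩ := hblock k
    refine ⟨j, ?_, hyx j k hj1 hj2⟩
    have : i < j + 1 := hmono.lt_iff_lt.1 (hik.trans_lt hj2)
    omega
  · have hy1 : ∀ k, ‖y k‖ ≤ 1 := by
      intro k
      obtain ⟨j, hj1, hj2⟩ := hblock k
      rw [hyx j k hj1 hj2]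
      exact hP j _ (hPX j (N j)) k
    have hge : ∀ m : ℕ, (m : ℝ) * (1 / 4) ≤ ∑ n ∈ Finset.range (N m), ‖tr c y n‖ := by
      intro m
      induction m with
      | zero => simp [hN0]
      | succ m ih =>
        have h1 := hX m (N m) y (fun k _ => hy1 k) fun k hk1 hk2 => hyx m k hk1 hk2
        rw [← hNs, Finset.sum_Ico_eq_sub _ (hmono (Nat.lt_succ_self m)).le] at h1
        push_cast
        linarith
    obtain ⟨m, hm⟩ := exists_nat_gt (4 * ∑' n, ‖tr c y n‖)
    have h1 := hsum.sum_le_tsum (Finset.range (N m)) fun _ _ => norm_nonneg _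
    have := hge m
    linarith

/-! ### Necessity of the conditions. -/

theorem tr_eq_sum_of_support (c : ℕ → ℕ → 𝕜) (hc : ∀ n k, n < k → c n k = 0) (x : ℕ → 𝕜)
    (S : Finset ℕ) (hx : ∀ k, k ∉ S → x k = 0) (n : ℕ) :
    tr c x n = ∑ k ∈ S, c n k * x k := by
  rw [tr, Finset.sum_subset (Finset.subset_union_left (s₂ := S)), eq_comm,
    Finset.sum_subset (Finset.subset_union_right (s₁ := Finset.range (n + 1)))]
  · intro k _ hk
    rw [hx k hk, mul_zero]
  · intro k _ hk
    rw [hc n k (by simpa using hk), zero_mul]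

theorem summable_column (c : ℕ → ℕ → 𝕜) (hc : ∀ n k, n < k → c n k = 0) (X : Set (ℕ → 𝕜))
    (h : ∀ y ∈ X, Summable fun n => ‖tr c y n‖) (k : ℕ) (hk : Pi.single k 1 ∈ X) :
    Summable fun n => ‖c n k‖ := by
  have h1 := h _ hk
  have h2 : ∀ n, tr c (Pi.single k 1) n = c n k := fun n => by
    rw [tr_eq_sum_of_support c hc _ {k} fun j hj => Pi.single_eq_of_ne (by simpa using hj) _]
    simp
  simpa only [h2] using h1

theorem tsum_enorm_ne_top {z : ℕ → 𝕜} (h : Summable fun n => ‖z n‖) : ∑' n, ‖z n‖ₑ ≠ ⊤ := by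
  simpa only [ofReal_norm] using h.tsum_ofReal_ne_top

theorem summable_norm_iff_tsum_enorm (z : ℕ → 𝕜) :
    (Summable fun n => ‖z n‖) ↔ ∑' n, ‖z n‖ₑ < ⊤ := by
  refine ⟨fun h => (tsum_enorm_ne_top h).lt_top, fun h => ?_⟩
  simpa only [toReal_enorm] using ENNReal.summable_toReal h.ne

theorem mem_lp_of_tsum (p : ℕ → ℝ) (y : ℕ → 𝕜) (h : ∑' k, ‖y k‖ₑ ^ p k ≠ ⊤) : y ∈ lp p := by
  have := ENNReal.summable_toReal h
  change Summable fun k => ‖y k‖ ^ p k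
  simpa only [← ENNReal.toReal_rpow, toReal_enorm] using this

theorem single_mem_c0 (p : ℕ → ℝ) (hp : ∀ k, 0 < p k) (k : ℕ) :
    (Pi.single k 1 : ℕ → 𝕜) ∈ c0 p := by
  refine tendsto_const_nhds.congr' ?_
  filter_upwards [Filter.eventually_gt_atTop k] with j hj
  rw [Pi.single_eq_of_ne hj.ne', norm_zero, Real.zero_rpow (hp j).ne']

theorem single_mem_lp (p : ℕ → ℝ) (hp : ∀ k, 0 < p k) (k : ℕ) :
    (Pi.single k 1 : ℕ → 𝕜) ∈ lp p := by
  refine summable_of_ne_finset_zero (s := {k}) fun j hj => ?_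
  rw [Pi.single_eq_of_ne (by simpa using hj), norm_zero, Real.zero_rpow (hp j).ne']

/-- If every `L` fails, `L = i + 1` yields blocks with entries `(i + 1) ^ (-1 / p k)`, hence `‖x k‖
^ p k = 1 / (i + 1)` on the support, and the glued sequence lies in `c0 p`. -/
theorem exists_bound_of_c0 (c : ℕ → ℕ → 𝕜) (hc : ∀ n k, n < k → c n k = 0) (p : ℕ → ℝ)
    (hp : ∀ k, 0 < p k) (h : ∀ y ∈ c0 p, Summable fun n => ‖tr c y n‖) :
    ∃ L : ℕ, 0 < L ∧ (⨆ F : Finset ℕ, ∑' n,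
      ‖∑ k ∈ F, c n k * (((L : ℝ) ^ (-1 / p k) : ℝ) : 𝕜)‖ₑ) < ⊤ := by
  by_contra! hL
  have hcol : ∀ k, Summable fun n => ‖c n k‖ := fun k =>
    summable_column c hc _ h k (single_mem_c0 p hp k)
  refine Exists.elim (exists_not_summable_tr c hcol
    (fun i x => ∀ k, ‖x k‖ ^ p k ≤ 1 / ((i : ℝ) + 1)) ?_ ?_) ?_
  · intro i x hx k
    have h1 : ‖x k‖ ^ p k ≤ 1 := (hx k).trans (by
      rw [div_le_one (by positivity)]
      have : (0 : ℝ) ≤ i := i.cast_nonneg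
      linarith)
    by_contra! hlt
    exact absurd (Real.one_lt_rpow hlt (hp k)) (not_lt.2 h1)
  · intro i K
    set w : ℕ → ℝ := fun k => ((i + 1 : ℕ) : ℝ) ^ (-1 / p k) with hw
    have hpos : (0 : ℝ) < (i + 1 : ℕ) := by positivity
    have hw0 : ∀ k, 0 ≤ w k := fun k => Real.rpow_nonneg hpos.le _
    have hw1 : ∀ k, w k ≤ 1 := fun k => by
      refine Real.rpow_le_one_of_one_le_of_nonpos (by simp) ?_
      exact div_nonpos_of_nonpos_of_nonneg (by norm_num) (hp k).le
    set A := ∑ k ∈ Finset.range K, ∑' n, ‖c n k‖ₑ with hA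
    have hAtop : A ≠ ⊤ := ENNReal.sum_ne_top.2 fun k _ => tsum_enorm_ne_top (hcol k)
    -- Discarding the indices below `K` costs at most `A`, which leaves norm at least 1.
    obtain ⟨F, hF⟩ := lt_iSup_iff.1
      ((ENNReal.add_lt_top.2 ⟨hAtop.lt_top, ENNReal.one_lt_top⟩).trans_le (hL (i + 1) (by omega)))
    set x : ℕ → 𝕜 := fun k => if k ∈ F ∧ K ≤ k then (w k : 𝕜) else 0 with hx
    have htr : ∀ n, tr c x n = ∑ k ∈ F with K ≤ k, c n k * (w k : 𝕜) := fun n => by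
      rw [tr_eq_sum_of_support c hc x (F.filter (K ≤ ·))
        fun k hk => if_neg (by simpa [Finset.mem_filter] using hk)]
      refine Finset.sum_congr rfl fun k hk => ?_
      rw [hx]
      simp only [if_pos (Finset.mem_filter.1 hk)]
    refine ⟨x, F.sup id + 1, fun k hk => if_neg (by omega), fun k hk => if_neg ?_, fun k => ?_, ?_⟩
    · rintro ⟨hkF, -⟩
      have : k ≤ F.sup id := Finset.le_sup (f := id) hkF
      omega
    · by_cases hk : k ∈ F ∧ K ≤ k
      · rw [hx]
        simp only [if_pos hk]
        rw [RCLike.norm_of_nonneg (hw0 k), hw, ← Real.rpow_mul hpos.le,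
          div_mul_cancel₀ _ (hp k).ne', Real.rpow_neg_one, one_div]
        push_cast
        exact le_rfl
      · rw [hx]
        simp only [if_neg hk]
        rw [norm_zero, Real.zero_rpow (hp k).ne']
        positivity
    · have hle : ∑' n, ‖∑ k ∈ F, c n k * (w k : 𝕜)‖ₑ ≤ A + ∑' n, ‖tr c x n‖ₑ := by
        have hA' : A = ∑' n, ∑ k ∈ Finset.range K, ‖c n k‖ₑ :=
          (Summable.tsum_finsetSum fun _ _ => ENNReal.summable).symm
        rw [hA', ← ENNReal.tsum_add]
        refine ENNReal.tsum_le_tsum fun n => ?_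
        rw [htr, ← Finset.sum_filter_add_sum_filter_not F (K ≤ ·), add_comm]
        refine (enorm_add_le _ _).trans (add_le_add_left ?_ _)
        refine (enorm_sum_le _ _).trans ?_
        calc ∑ k ∈ F with ¬ K ≤ k, ‖c n k * (w k : 𝕜)‖ₑ ≤ ∑ k ∈ F with ¬ K ≤ k, ‖c n k‖ₑ := by
              refine Finset.sum_le_sum fun k _ => ?_
              rw [enorm_mul]
              refine mul_le_of_le_one_right' ?_
              rw [← ofReal_norm, RCLike.norm_of_nonneg (hw0 k)]
              exact ENNReal.ofReal_le_one.2 (hw1 k)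
          _ ≤ _ := Finset.sum_le_sum_of_subset fun k hk => by
              simp only [Finset.mem_filter, Finset.mem_range] at *
              omega
      exact (ENNReal.add_le_add_iff_left hAtop).1 (hF.le.trans hle)
  · rintro N ⟨x, y, -, hx, hy, hns⟩
    refine hns (h y ?_)
    refine Metric.tendsto_atTop.2 fun ε hε => ?_
    obtain ⟨i, hi⟩ := exists_nat_one_div_lt hε
    refine ⟨N i, fun k hk => ?_⟩
    obtain ⟨j, hj, hjk⟩ := hy i k hk
    rw [dist_zero_right, Real.norm_of_nonneg (by positivity), hjk]
    exact ((hx j k).trans (one_div_le_one_div_of_le (by positivity) (by gcongr))).trans_lt hi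

/-- Multiplying a null sequence by `L ^ (1 / p k)` gives an element of `linf p`, so the weighted
matrix falls under the `c0` case with exponent 1. The resulting factor `1 / L'` is a constant and is
multiplied away. -/
theorem bound_of_linf (c : ℕ → ℕ → 𝕜) (hc : ∀ n k, n < k → c n k = 0) (p : ℕ → ℝ)
    (hp : ∀ k, 0 < p k) (hpb : BddAbove (Set.range p))
    (h : ∀ y ∈ linf p, Summable fun n => ‖tr c y n‖) (L : ℕ) (hL : 0 < L) :
    (⨆ F : Finset ℕ, ∑' n, ‖∑ k ∈ F, c n k * (((L : ℝ) ^ (1 / p k) : ℝ) : 𝕜)‖ₑ) < ⊤ := by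
  have hL' : (0 : ℝ) < L := by exact_mod_cast hL
  set w : ℕ → ℝ := fun k => (L : ℝ) ^ (1 / p k) with hw
  have hw0 : ∀ k, 0 ≤ w k := fun k => Real.rpow_nonneg hL'.le _
  have hwp : ∀ k, w k ^ p k = L := fun k => by
    rw [hw, ← Real.rpow_mul hL'.le, div_mul_cancel₀ _ (hp k).ne', Real.rpow_one]
  obtain ⟨Q, hQ⟩ := hpb
  obtain ⟨L', hL0, hlt⟩ := exists_bound_of_c0 (fun n k => c n k * (w k : 𝕜))
    (fun n k hnk => by rw [hc n k hnk, zero_mul]) (fun _ => 1) (fun _ => one_pos) fun y hy => by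
      rw [tr_mul_right]
      have hy' : Filter.Tendsto (fun k => ‖y k‖ ^ (1 : ℝ)) Filter.atTop (nhds 0) := hy
      simp only [Real.rpow_one] at hy'
      obtain ⟨B, hB⟩ := hy'.bddAbove_range
      -- Boundedness of `p` enters here; a base at least 1 lets the exponent `p k` be replaced by
      -- `Q`.
      refine h _ ⟨L * max 1 B ^ Q, ?_⟩
      rintro _ ⟨k, rfl⟩
      have hyB : ‖y k‖ ≤ max 1 B := (hB (Set.mem_range_self k)).trans (le_max_right _ _)
      simp only
      rw [norm_mul, RCLike.norm_of_nonneg (hw0 k), Real.mul_rpow (hw0 k) (norm_nonneg _), hwp]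
      refine mul_le_mul_of_nonneg_left ?_ hL'.le
      exact (Real.rpow_le_rpow (norm_nonneg _) hyB (hp k).le).trans
        (Real.rpow_le_rpow_of_exponent_le (le_max_left _ _) (hQ (Set.mem_range_self k)))
  have hL'𝕜 : (L' : 𝕜) ≠ 0 := by exact_mod_cast hL0.ne'
  refine (iSup_le fun F => ?_).trans_lt (ENNReal.mul_lt_top (enorm_lt_top (x := (L' : 𝕜))) hlt)
  refine le_trans ?_ (mul_le_mul_right (le_iSup _ F) _)
  rw [← ENNReal.tsum_mul_left]
  refine ENNReal.tsum_le_tsum fun n => ?_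
  rw [← enorm_mul, Finset.mul_sum]
  refine le_of_eq (congrArg _ (Finset.sum_congr rfl fun k _ => ?_))
  rw [div_one, Real.rpow_neg_one, RCLike.ofReal_inv, RCLike.ofReal_natCast]
  field_simp
  rfl

/-- The budgets `2⁻¹ ^ i` are summable, so the glued sequence stays in `lp p`. -/
theorem exists_not_summable_tr_of_lp (c : ℕ → ℕ → 𝕜) (p : ℕ → ℝ) (hp : ∀ k, 0 < p k)
    (hcol : ∀ k, Summable fun n => ‖c n k‖)
    (h : ∀ i K : ℕ, ∃ (x : ℕ → 𝕜) (K' : ℕ), (∀ k, k < K → x k = 0) ∧ (∀ k, K' ≤ k → x k = 0) ∧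
      ∑' k, ‖x k‖ₑ ^ p k ≤ ENNReal.ofReal (2⁻¹ ^ i) ∧ ∃ F : Finset ℕ, 1 ≤ ‖∑ n ∈ F, tr c x n‖ₑ) :
    ∃ y ∈ lp p, ¬ Summable fun n => ‖tr c y n‖ := by
  refine Exists.elim (exists_not_summable_tr c hcol
    (fun i x => ∑' k, ‖x k‖ₑ ^ p k ≤ ENNReal.ofReal (2⁻¹ ^ i)) ?_ ?_) ?_
  · intro i x hx k
    have h1 : ‖x k‖ₑ ^ p k ≤ 1 :=
      ((ENNReal.le_tsum (f := fun k => ‖x k‖ₑ ^ p k) k).trans hx).trans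
        (ENNReal.ofReal_le_one.2 (pow_le_one₀ (by norm_num) (by norm_num)))
    by_contra! hlt
    have h2 : 1 < ‖x k‖ₑ := by
      rw [← ofReal_norm]
      exact ENNReal.one_lt_ofReal.2 hlt
    exact absurd (ENNReal.one_lt_rpow h2 (hp k)) (not_lt.2 h1)
  · intro i K
    obtain ⟨x, K', h1, h2, h3, F, hF⟩ := h i K
    exact ⟨x, K', h1, h2, h3, hF.trans ((enorm_sum_le _ _).trans (ENNReal.sum_le_tsum F))⟩
  · rintro N ⟨x, y, hN0, hx, hy, hns⟩
    refine ⟨y, mem_lp_of_tsum p y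
      (ne_top_of_le_ne_top (b := ∑' i : ℕ, ENNReal.ofReal (2⁻¹ ^ i)) ?_ ?_), hns⟩
    · exact (summable_geometric_of_lt_one (by norm_num) (by norm_num)).tsum_ofReal_ne_top
    · calc ∑' k, ‖y k‖ₑ ^ p k ≤ ∑' k, ∑' i, ‖x i k‖ₑ ^ p k := by
            refine ENNReal.tsum_le_tsum fun k => ?_
            obtain ⟨j, -, hj⟩ := hy 0 k (by omega)
            rw [hj]
            exact ENNReal.le_tsum (f := fun i => ‖x i k‖ₑ ^ p k) j
        _ = ∑' i, ∑' k, ‖x i k‖ₑ ^ p k := ENNReal.tsum_comm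
        _ ≤ _ := ENNReal.tsum_le_tsum hx

/-- One-entry blocks suffice: some column sum has `p k`-th power above `2 ^ i`, and an entry of size
`2 ^ (-i / p k)` there gives a sum of norm at least 1. The threshold also exceeds what columns below
`K` can attain, which forces `K ≤ k`. -/
theorem bound_of_lp (c : ℕ → ℕ → 𝕜) (hc : ∀ n k, n < k → c n k = 0)
    (p : ℕ → ℝ) (hp : ∀ k, 0 < p k) (h : ∀ y ∈ lp p, Summable fun n => ‖tr c y n‖) :
    (⨆ F : Finset ℕ, ⨆ k : ℕ, ‖∑ n ∈ F, c n k‖ₑ ^ p k) < ⊤ := by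
  by_contra! htop
  have hcol : ∀ k, Summable fun n => ‖c n k‖ := fun k =>
    summable_column c hc _ h k (single_mem_lp p hp k)
  suffices ∃ y ∈ lp p, ¬ Summable fun n => ‖tr c y n‖ by
    obtain ⟨y, hy, hns⟩ := this
    exact hns (h y hy)
  refine exists_not_summable_tr_of_lp c p hp hcol fun i K => ?_
  have hB : ∑ k ∈ Finset.range K, (∑' n, ‖c n k‖ₑ) ^ p k + 2 ^ i < ⊤ := by
    refine ENNReal.add_lt_top.2 ⟨ENNReal.sum_lt_top.2 fun k _ => ?_, ENNReal.pow_lt_top (by simp)⟩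
    exact ENNReal.rpow_lt_top_of_nonneg (hp k).le (tsum_enorm_ne_top (hcol k))
  obtain ⟨F, hF⟩ := lt_iSup_iff.1 (hB.trans_le htop)
  obtain ⟨k, hk⟩ := lt_iSup_iff.1 hF
  have hKk : K ≤ k := by
    by_contra! hlt
    refine absurd hk (not_lt.2 ?_)
    refine le_trans ?_ (le_self_add.trans' (Finset.single_le_sum
      (f := fun k => (∑' n, ‖c n k‖ₑ) ^ p k) (fun _ _ => zero_le) (Finset.mem_range.2 hlt)))
    exact ENNReal.rpow_le_rpow ((enorm_sum_le _ _).trans (ENNReal.sum_le_tsum F)) (hp k).le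
  set v : ℝ := ((2 : ℝ)⁻¹ ^ i) ^ (p k)⁻¹ with hv
  have hv0 : 0 ≤ v := by positivity
  have hvp : ‖(v : 𝕜)‖ₑ ^ p k = ENNReal.ofReal (2⁻¹ ^ i) := by
    rw [← ofReal_norm, RCLike.norm_of_nonneg hv0, ENNReal.ofReal_rpow_of_nonneg hv0 (hp k).le, hv,
      Real.rpow_inv_rpow (by positivity) (hp k).ne']
  refine ⟨Pi.single k (v : 𝕜), k + 1, fun j hj => Pi.single_eq_of_ne (by omega) _,
    fun j hj => Pi.single_eq_of_ne (by omega) _, ?_, F, ?_⟩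
  · rw [tsum_eq_single k]
    · rw [Pi.single_eq_same, hvp]
    · intro j hj
      rw [Pi.single_eq_of_ne hj, enorm_zero, ENNReal.zero_rpow_of_pos (hp j)]
  · have htr : ∀ n, tr c (Pi.single k (v : 𝕜)) n = c n k * v := fun n => by
      rw [tr_eq_sum_of_support c hc _ {k} fun j hj => Pi.single_eq_of_ne (by simpa using hj) _]
      simp
    simp only [htr]
    rw [← Finset.sum_mul]
    by_contra! hlt
    refine absurd (ENNReal.rpow_lt_one hlt (hp k)) (not_lt.2 ?_)
    rw [enorm_mul, ENNReal.mul_rpow_of_nonneg _ _ (hp k).le, hvp]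
    calc (1 : ENNReal) = 2 ^ i * ENNReal.ofReal (2⁻¹ ^ i) := by
          rw [ENNReal.ofReal_pow (by norm_num), ENNReal.ofReal_inv_of_pos (by norm_num), ← mul_pow]
          simp [ENNReal.mul_inv_cancel]
      _ ≤ _ := mul_le_mul_left (le_add_self.trans hk.le) _

/-- The blocks are equality cases of Hölder: `x k` is `θ * ‖d k‖ ^ (q k - 2)` times the conjugate of
`d k`. As `(q k - 1) * p k = q k` and `θ ≤ 1`, the cost is at most `θ * S = δ`, while the pairing
with the column sums is `L * θ * S = L * δ = 1`. -/
theorem exists_bound_of_lp_of_one_lt (c : ℕ → ℕ → 𝕜) (hc : ∀ n k, n < k → c n k = 0)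
    (p : ℕ → ℝ) (hp1 : ∀ k, 1 < p k) (h : ∀ y ∈ lp p, Summable fun n => ‖tr c y n‖) :
    ∃ L : ℕ, 0 < L ∧ (⨆ F : Finset ℕ, ∑' k,
      ‖∑ n ∈ F, c n k * (L : 𝕜)⁻¹‖ₑ ^ (p k / (p k - 1))) < ⊤ := by
  by_contra! htop
  have hp : ∀ k, 0 < p k := fun k => one_pos.trans (hp1 k)
  set q : ℕ → ℝ := fun k => p k / (p k - 1) with hq
  have hpq : ∀ k, (p k).HolderConjugate (q k) := fun k =>
    Real.HolderConjugate.conjExponent (hp1 k)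
  have hq0 : ∀ k, 0 < q k := fun k => (hpq k).symm.pos
  have hcol : ∀ k, Summable fun n => ‖c n k‖ := fun k =>
    summable_column c hc _ h k (single_mem_lp p hp k)
  suffices ∃ y ∈ lp p, ¬ Summable fun n => ‖tr c y n‖ by
    obtain ⟨y, hy, hns⟩ := this
    exact hns (h y hy)
  refine exists_not_summable_tr_of_lp c p hp hcol fun i K => ?_
  set L : ℕ := 2 ^ i with hL
  have hL𝕜 : (L : 𝕜) ≠ 0 := by simp [hL]
  set δ : ℝ := 2⁻¹ ^ i with hδ
  have hδ0 : 0 < δ := by positivity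
  have hLδ : (L : ℝ) * δ = 1 := by
    rw [hL, hδ, Nat.cast_pow, ← mul_pow]; norm_num
  have hcolL : ∀ k, Summable fun n => ‖c n k * (L : 𝕜)⁻¹‖ := fun k => by
    simpa only [norm_mul] using (hcol k).mul_right _
  set A := ∑ k ∈ Finset.range K, (∑' n, ‖c n k * (L : 𝕜)⁻¹‖ₑ) ^ q k with hA
  have hAtop : A < ⊤ := ENNReal.sum_lt_top.2 fun k _ =>
    ENNReal.rpow_lt_top_of_nonneg (hq0 k).le (tsum_enorm_ne_top (hcolL k))
  -- `A` bounds the part below `K`, so the remaining part `S` exceeds `δ`; this makes `θ ≤ 1`.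
  obtain ⟨F, hF⟩ := lt_iSup_iff.1 ((ENNReal.add_lt_top.2 ⟨hAtop,
    ENNReal.ofReal_lt_top (r := δ)⟩).trans_le (htop L (by positivity)))
  set d : ℕ → 𝕜 := fun k => ∑ n ∈ F, c n k * (L : 𝕜)⁻¹ with hd
  have hcd : ∀ k, ∑ n ∈ F, c n k = L * d k := fun k => by
    simp only [hd]
    rw [← Finset.sum_mul, mul_left_comm, mul_inv_cancel₀ hL𝕜, mul_one]
  set N := F.sup id + 1 with hN
  have hdN : ∀ k, N ≤ k → d k = 0 := fun k hk => Finset.sum_eq_zero fun n hn => by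
    have : n ≤ F.sup id := Finset.le_sup (f := id) hn
    rw [hc n k (by omega), zero_mul]
  set S : ℝ := ∑ k ∈ Finset.Ico K N, ‖d k‖ ^ q k with hS
  have hδS : δ < S := by
    have h1 : ∑' k, ‖d k‖ₑ ^ q k ≤ A + ENNReal.ofReal S := by
      rw [tsum_eq_sum (s := Finset.range N)]
      · rw [hS, ENNReal.ofReal_sum_of_nonneg fun _ _ => by positivity]
        calc ∑ k ∈ Finset.range N, ‖d k‖ₑ ^ q k
            ≤ ∑ k ∈ Finset.range K ∪ Finset.Ico K N, ‖d k‖ₑ ^ q k :=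
              Finset.sum_le_sum_of_subset fun k hk => by
                simp only [Finset.mem_union, Finset.mem_range, Finset.mem_Ico] at *
                omega
          _ = ∑ k ∈ Finset.range K, ‖d k‖ₑ ^ q k + ∑ k ∈ Finset.Ico K N, ‖d k‖ₑ ^ q k :=
              Finset.sum_union (Finset.disjoint_left.2 fun k hk hk' => by
                simp only [Finset.mem_range, Finset.mem_Ico] at *
                omega)
          _ ≤ _ := by
              refine add_le_add (Finset.sum_le_sum fun k _ => ?_)
                (Finset.sum_le_sum fun k _ => ?_)
              · exact ENNReal.rpow_le_rpow ((enorm_sum_le _ _).trans (ENNReal.sum_le_tsum F))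
                  (hq0 k).le
              · rw [← ENNReal.ofReal_rpow_of_nonneg (norm_nonneg _) (hq0 k).le, ofReal_norm]
      · intro k hk
        rw [hdN k (by simpa using hk), enorm_zero, ENNReal.zero_rpow_of_pos (hq0 k)]
    have h2 := (ENNReal.add_lt_add_iff_left hAtop.ne).1 (hF.trans_le h1)
    exact (ENNReal.ofReal_lt_ofReal_iff_of_nonneg hδ0.le).1 h2
  have hS0 : 0 < S := hδ0.trans hδS
  set θ : ℝ := δ / S with hθ
  have hθ0 : 0 < θ := div_pos hδ0 hS0
  have hθ1 : θ ≤ 1 := (div_le_one hS0).2 hδS.le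
  have hθS : θ * S = δ := div_mul_cancel₀ _ hS0.ne'
  -- Where `d k = 0`, division by zero returns 0 and so `x k = 0`.
  set x : ℕ → 𝕜 := fun k => if k ∈ Finset.Ico K N then
    ((θ * (‖d k‖ ^ (q k - 1) / ‖d k‖) : ℝ) : 𝕜) * (starRingEnd 𝕜) (d k) else 0 with hx
  have hx1 : ∀ k ∈ Finset.Ico K N, x k =
      ((θ * (‖d k‖ ^ (q k - 1) / ‖d k‖) : ℝ) : 𝕜) * (starRingEnd 𝕜) (d k) := fun k hk =>
    if_pos hk
  have hx0 : ∀ k, k ∉ Finset.Ico K N → x k = 0 := fun k hk => if_neg hk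
  have hq1 : ∀ k, 0 < q k - 1 := fun k => sub_pos.2 (hpq k).symm.lt
  have hnorm : ∀ k ∈ Finset.Ico K N, ‖x k‖ ^ p k ≤ θ * ‖d k‖ ^ q k := by
    intro k hk
    have h1 : ‖x k‖ = θ * ‖d k‖ ^ (q k - 1) := by
      rw [hx1 k hk, norm_mul, RCLike.norm_of_nonneg (by positivity), RCLike.norm_conj, mul_assoc]
      congr 1
      by_cases h0 : ‖d k‖ = 0
      · rw [h0, Real.zero_rpow (hq1 k).ne', mul_zero]
      · rw [div_mul_cancel₀ _ h0]
    have h2 : (q k - 1) * p k = q k := by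
      have : p k - 1 ≠ 0 := (sub_pos.2 (hp1 k)).ne'
      simp only [hq]
      field_simp
      ring
    rw [h1, Real.mul_rpow hθ0.le (by positivity), ← Real.rpow_mul (norm_nonneg _), h2]
    exact mul_le_mul_of_nonneg_right (Real.rpow_le_self_of_le_one hθ0.le hθ1 (hp1 k).le)
      (by positivity)
  have hpair : ∀ k ∈ Finset.Ico K N, d k * x k = ((θ * ‖d k‖ ^ q k : ℝ) : 𝕜) := by
    intro k hk
    rw [hx1 k hk, mul_left_comm, RCLike.mul_conj, ← RCLike.ofReal_pow, ← RCLike.ofReal_mul]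
    congr 1
    by_cases h0 : ‖d k‖ = 0
    · rw [h0, Real.zero_rpow (hq0 k).ne']; ring
    · rw [Real.rpow_sub_one h0]
      field_simp
  refine ⟨x, N, fun k hk => hx0 k (by simp; omega), fun k hk => hx0 k (by simp; omega), ?_, F, ?_⟩
  · rw [tsum_eq_sum (s := Finset.Ico K N)]
    · calc ∑ k ∈ Finset.Ico K N, ‖x k‖ₑ ^ p k
          = ENNReal.ofReal (∑ k ∈ Finset.Ico K N, ‖x k‖ ^ p k) := by
            rw [ENNReal.ofReal_sum_of_nonneg fun _ _ => by positivity]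
            refine Finset.sum_congr rfl fun k _ => ?_
            rw [← ENNReal.ofReal_rpow_of_nonneg (norm_nonneg _) (hp k).le, ofReal_norm]
        _ ≤ ENNReal.ofReal δ := by
            refine ENNReal.ofReal_le_ofReal ((Finset.sum_le_sum hnorm).trans ?_)
            rw [← Finset.mul_sum, ← hS, hθS]
    · intro k hk
      rw [hx0 k hk, enorm_zero, ENNReal.zero_rpow_of_pos (hp k)]
  · have h1 : ∑ n ∈ F, tr c x n = 1 := by
      simp only [tr_eq_sum_of_support c hc x _ hx0]
      rw [Finset.sum_comm]
      simp only [← Finset.sum_mul, hcd, mul_assoc]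
      rw [← Finset.mul_sum, Finset.sum_congr rfl hpair, ← RCLike.ofReal_sum, ← Finset.mul_sum,
        ← hS, hθS, ← RCLike.ofReal_natCast, ← RCLike.ofReal_mul, hLδ, RCLike.ofReal_one]
    rw [h1, enorm_one]

/-! ### The space `c(p)` and the final assembly. -/

theorem const_mem_c (p : ℕ → ℝ) (hp : ∀ k, 0 < p k) : (fun _ => 1 : ℕ → 𝕜) ∈ c p := by
  refine ⟨1, tendsto_const_nhds.congr fun k => ?_⟩
  rw [sub_self, norm_zero, Real.zero_rpow (hp k).ne']

theorem c0_subset_c (p : ℕ → ℝ) : (c0 p : Set (ℕ → 𝕜)) ⊆ c p := fun y hy =>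
  ⟨0, by simp only [sub_zero]; exact hy⟩

theorem tsum_C (r s t a : ℕ → 𝕜) (n : ℕ) :
    ∑' k, C r s t a n k = tr (C r s t a) (fun _ => 1) n := by
  rw [tsum_eq_sum (s := Finset.range (n + 1)), tr]
  · simp only [mul_one]
  · intro k hk
    exact C_eq_zero r s t a n k (by simpa using hk)

/-- A matrix maps `c(p)` into `l₁` iff it maps `c₀(p)` and the constant sequence `1` into `l₁`. -/
theorem forall_mem_c_iff (b : ℕ → ℕ → 𝕜) (p : ℕ → ℝ) (hp : ∀ k, 0 < p k) :
    (∀ y ∈ c p, Summable fun n => ‖tr b y n‖) ↔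
      (∀ y ∈ c0 p, Summable fun n => ‖tr b y n‖) ∧ Summable fun n => ‖tr b (fun _ => 1) n‖ := by
  refine ⟨fun h => ⟨fun y hy => h y (c0_subset_c p hy), h _ (const_mem_c p hp)⟩, ?_⟩
  rintro ⟨h0, h1⟩ y ⟨l, hl⟩
  -- The decomposition is `y = (y - l) + l • 1`.
  have h2 := (h0 (fun k => y k - l) hl).add (h1.mul_left ‖l‖)
  refine h2.of_nonneg_of_le (fun _ => norm_nonneg _) fun n => ?_
  rw [← norm_mul]
  refine le_trans (le_of_eq (congrArg _ ?_)) (norm_add_le _ _)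
  simp only [tr, Finset.mul_sum, ← Finset.sum_add_distrib]
  exact Finset.sum_congr rfl fun k _ => by ring

end GenMeans

theorem theorem4p3 {𝕜 : Type*} [RCLike 𝕜] (r s t : ℕ → 𝕜) (p : ℕ → ℝ)
    (hr : ∀ n, r n ≠ 0) (ht : ∀ n, t n ≠ 0) (hs : s 0 ≠ 0)
    (hp : ∀ k, 0 < p k) (hpb : BddAbove (Set.range p)) :
    ((∀ k, 1 < p k) →
      GenMeans.alphaDual (GenMeans.space (GenMeans.lp p) r s t) = GenMeans.H5 r s t p) ∧
    ((∀ k, p k ≤ 1) →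
      GenMeans.alphaDual (GenMeans.space (GenMeans.lp p) r s t) = GenMeans.H4 r s t p) ∧
    GenMeans.alphaDual (GenMeans.space (GenMeans.c0 p) r s t) = GenMeans.H1 r s t p ∧
    GenMeans.alphaDual (GenMeans.space (GenMeans.c p) r s t) =
      GenMeans.H1 r s t p ∩ GenMeans.H2 r s t ∧
    GenMeans.alphaDual (GenMeans.space (GenMeans.linf p) r s t) = GenMeans.H3 r s t p := by
  have hC := fun a => GenMeans.C_eq_zero r s t a
  have key := GenMeans.mem_alphaDual_space_iff r s t hr ht hs
  have hc0 : ∀ a, (∀ y ∈ GenMeans.c0 p, Summable fun n => ‖GenMeans.tr (GenMeans.C r s t a) y n‖) ↔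
      a ∈ GenMeans.H1 r s t p := fun a =>
    ⟨fun h => GenMeans.exists_bound_of_c0 _ (hC a) p hp h, fun ⟨L, hL, h⟩ y hy =>
      GenMeans.summable_tr_of_mem_c0 _ (hC a) p hp L hL h y hy⟩
  refine ⟨fun hp1 => ?_, fun hp1 => ?_, ?_, ?_, ?_⟩ <;> ext a <;> rw [key]
  · exact ⟨fun h => GenMeans.exists_bound_of_lp_of_one_lt _ (hC a) p hp1 h, fun ⟨L, hL, h⟩ y hy =>
      GenMeans.summable_tr_of_mem_lp_of_one_lt _ (hC a) p hp1 L hL h y hy⟩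
  · exact ⟨fun h => GenMeans.bound_of_lp _ (hC a) p hp h, fun h y hy =>
      GenMeans.summable_tr_of_mem_lp_of_le_one _ (hC a) p hp hp1 h y hy⟩
  · exact hc0 a
  · rw [GenMeans.forall_mem_c_iff _ p hp, hc0, GenMeans.summable_norm_iff_tsum_enorm]
    simp only [← GenMeans.tsum_C]
    rfl
  · exact ⟨fun h L hL => GenMeans.bound_of_linf _ (hC a) p hp hpb h L hL, fun h y hy =>
      GenMeans.summable_tr_of_mem_linf _ (hC a) p hp h y hy⟩
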